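/- Corollary 3.2 (C-IDLA). Consider one-dimensional internal diffusion-limited aggregation: $A(0)=\{0\}$ and, for every $n\ge 0$, a new explorer performs a simple symmetric random walk on $\mathbb Z$ (steps $\pm1$ with probability $1/2$ each) started from the origin, independent of the previous explorers, and the first site outside $A(n)$ that it reaches is added to $A(n)$ to form $A(n+1)$. Let $L_n$ and $R_n$ be the minimum and the maximum of $A(n)$, and let $X_n=L_n+R_n$. For $a>1/8$ put $$c(a)=\frac{2\bigl(1-2a+2\sqrt{a(a+1)}\bigr)}{8a-1},$$ and, for $n\ge 1$, $$c_n(a)=\Bigl(\frac{2n+1}{n+1}\Bigr)\Bigl(\frac{3+c(a)}{6}\Bigr)+\frac{n(1+c(a))+2c(a)}{(n+1)^2},\qquad d_n(a)=c_n(a)+\frac{n+2}{3n}.$$ Then, for every $n\ge 1$, every $a\in\,]1/8,9/16]$ and every $x>0$, $$\mathbb P\Bigl(\frac{|X_n|}{n}\ge x\Bigr)\le 2\exp\Bigl(-\frac{nx^2}{2a\,c_n(a)}\Bigr)$$ and $$\mathbb P\Bigl(\frac{|X_n|}{\sqrt n}\ge x\Bigr)\le \bigl(d_n(a)\bigr)^{1/3}x^{-2/3}\exp\Bigl(-\frac{x^2}{3d_n(a)}\Bigr).$$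 -/

import Mathlib

open MeasureTheory ProbabilityTheory

namespace IDLA

/-- Position at time `j` of the walk on `ℤ` which starts from the origin and has the increments
`s 0, s 1, …`. -/
def walk (s : ℕ → ℤ) (j : ℕ) : ℤ := ∑ i ∈ Finset.range j, s i

open Classical in
/-- The cluster `A` after an explorer with increments `s` has walked from the origin until the
first time it reaches a site outside `A`; that site is added to `A`.
(If the walk never leaves `A`, nothing is added; for the simple random walk this has
probability zero.) -/
noncomputable def settle (A : Finset ℤ) (s : ℕ → ℤ) : Finset ℤ :=
  if h : ∃ j, walk s j ∉ A then insert (walk s (Nat.find h)) A else A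

/-- The cluster `A(n)`: `A(0) = {0}`, and `A(n+1)` is obtained from `A(n)` by letting a new
explorer, with increments `s n 0, s n 1, …`, start from the origin and settle. -/
noncomputable def cluster (s : ℕ → ℕ → ℤ) : ℕ → Finset ℤ
  | 0 => {0}
  | n + 1 => settle (cluster s n) (s n)

theorem subset_settle (A : Finset ℤ) (s : ℕ → ℤ) : A ⊆ settle A s := by
  unfold settle
  split_ifs
  · exact Finset.subset_insert _ _
  · exact Finset.Subset.refl _

theorem cluster_nonempty (s : ℕ → ℕ → ℤ) (n : ℕ) : (cluster s n).Nonempty := by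
  induction n with
  | zero => exact Finset.singleton_nonempty 0
  | succ n ih => exact ih.mono (subset_settle _ _)

/-- `L_n`, the minimum of the cluster `A(n)`. -/
noncomputable def L (s : ℕ → ℕ → ℤ) (n : ℕ) : ℤ := (cluster s n).min' (cluster_nonempty s n)

/-- `R_n`, the maximum of the cluster `A(n)`. -/
noncomputable def R (s : ℕ → ℕ → ℤ) (n : ℕ) : ℤ := (cluster s n).max' (cluster_nonempty s n)

/-- `X_n = L_n + R_n`. -/
noncomputable def X (s : ℕ → ℕ → ℤ) (n : ℕ) : ℤ := L s n + R s n

/-- The function `c(a) = 2 (1 - 2a + 2 √(a (a + 1))) / (8a - 1)`. -/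
noncomputable def c (a : ℝ) : ℝ := 2 * (1 - 2 * a + 2 * Real.sqrt (a * (a + 1))) / (8 * a - 1)

/-- The constant `c_n(a)`. -/
noncomputable def cn (n : ℕ) (a : ℝ) : ℝ :=
  ((2 * (n : ℝ) + 1) / ((n : ℝ) + 1)) * ((3 + c a) / 6)
    + ((n : ℝ) * (1 + c a) + 2 * c a) / ((n : ℝ) + 1) ^ 2

/-- The constant `d_n(a)`. -/
noncomputable def dn (n : ℕ) (a : ℝ) : ℝ := cn n a + ((n : ℝ) + 2) / (3 * (n : ℝ))

end IDLA

/-! The cluster is almost surely an interval of `n + 1` points, and the next explorer stops at one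
of its two outer neighbours. Its final position is half the increment of `(n + 1) X_n`, so optional
stopping makes `(n + 1) X_n` a martingale (`integral_comp_process_mul_increment`). Given the past,
the increment takes only the two values `X_n ± (n + 2)`. Two estimates follow. Hoeffding's lemma
gives `(n + 1) X_n` the variance proxy `∑ (k + 2) ^ 2` (`integral_exp_le`), which is at most `a n (n
+ 1) ^ 2 c_n(a)` because `a (1 + c(a)) ≥ 1`; this is the first bound. A recursion for second moments
gives `E X_n ^ 2 ≤ (n + 2) / 3` (`integral_process_sq_le`), hence a Chebyshev bound. For the second
bound put `u = x ^ 2 / d_n(a)`, so that the right side is `(u exp u) ^ (-1/3)`. The trivial bound,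
Chebyshev and the sub-Gaussian bound cover small, middle and large `u`
(`le_exp_neg_log_add_div_three`). The restriction `a ≤ 9/16` gives both `c(a) ≥ 1` and the rate
`8/9` in the sub-Gaussian bound. -/

namespace IDLA

/-! ### The constants -/

theorem eight_mul_sub_one_mul_c {a : ℝ} (ha : 1 / 8 < a) :
    (8 * a - 1) * c a = 2 * (1 - 2 * a + 2 * Real.sqrt (a * (a + 1))) := by
  have : 8 * a - 1 ≠ 0 := by linarith
  unfold c
  field_simp

/-- This is what lets `a c_n(a)` dominate the Hoeffding proxy term by term in `proxy_le`. -/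
theorem one_le_mul_one_add_c {a : ℝ} (ha : 1 / 8 < a) : 1 ≤ a * (1 + c a) := by
  have hs : 7 * a - 1 - 4 * a ^ 2 ≤ 4 * a * Real.sqrt (a * (a + 1)) := by
    have h : (7 * a - 1 - 4 * a ^ 2) ^ 2 ≤ (4 * a * Real.sqrt (a * (a + 1))) ^ 2 := by
      rw [mul_pow, Real.sq_sqrt (by positivity)]
      -- The difference of the two squares is exactly `(8a - 1)(3a - 1) ^ 2`.
      nlinarith [mul_nonneg (by linarith : (0 : ℝ) ≤ 8 * a - 1) (sq_nonneg (3 * a - 1))]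
    exact (abs_le_of_sq_le_sq' h (by positivity)).2
  have hc := eight_mul_sub_one_mul_c ha
  have h8 : 0 < 8 * a - 1 := by linarith
  refine le_of_mul_le_mul_left ?_ h8
  nlinarith

theorem one_le_c {a : ℝ} (ha : a ∈ Set.Ioc (1 / 8 : ℝ) (9 / 16)) : 1 ≤ c a := by
  obtain ⟨h1, h2⟩ := ha
  have hs : 12 * a - 3 ≤ 4 * Real.sqrt (a * (a + 1)) := by
    have h : (12 * a - 3) ^ 2 ≤ (4 * Real.sqrt (a * (a + 1))) ^ 2 := by
      rw [mul_pow, Real.sq_sqrt (by nlinarith)]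
      -- The difference of the two squares is `(8a - 1)(9 - 16a)`: the endpoint `9/16` is where `c a
      -- = 1`.
      nlinarith
    exact (abs_le_of_sq_le_sq' h (by positivity)).2
  have hc := eight_mul_sub_one_mul_c h1
  have h8 : 0 < 8 * a - 1 := by linarith
  refine le_of_mul_le_mul_left ?_ h8
  nlinarith

/-- Unnormalising `c_n(a)` turns it into a sum over explorers that can be compared with `proxy` term
by term. -/
theorem mul_sq_mul_cn (n : ℕ) (a : ℝ) :
    (n : ℝ) * (n + 1) ^ 2 * cn n a =
      ∑ k ∈ Finset.range n, ((c a + 1) * ((k : ℝ) + 2) ^ 2 + 2 * k * (k + 2)) := by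
  have h (n : ℕ) : (n : ℝ) * (n + 1) ^ 2 * cn n a =
      n * (n + 1) * (2 * n + 1) * (3 + c a) / 6 + n * (n * (1 + c a) + 2 * c a) := by
    unfold cn
    field_simp
  rw [h]
  induction n with
  | zero => simp
  | succ n ih =>
    rw [Finset.sum_range_succ, ← ih]
    push_cast
    ring

/-- The variance proxy of the martingale `(n + 1) X_n`. -/
noncomputable def proxy (n : ℕ) : ℝ := ∑ k ∈ Finset.range n, ((k : ℝ) + 2) ^ 2

theorem proxy_nonneg (n : ℕ) : 0 ≤ proxy n := Finset.sum_nonneg fun _ _ => by positivity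

theorem proxy_le {a : ℝ} (ha : 1 / 8 < a) (n : ℕ) :
    proxy n ≤ a * ((n : ℝ) * (n + 1) ^ 2 * cn n a) := by
  rw [mul_sq_mul_cn, Finset.mul_sum]
  refine Finset.sum_le_sum fun k _ => ?_
  have h1 := one_le_mul_one_add_c ha
  have h2 : 0 ≤ a * (2 * k * (k + 2)) := by positivity
  nlinarith [mul_le_mul_of_nonneg_right h1 (sq_nonneg ((k : ℝ) + 2))]

theorem proxy_pos {n : ℕ} (hn : 1 ≤ n) : 0 < proxy n :=
  Finset.sum_pos (fun _ _ => by positivity) ⟨0, Finset.mem_range.2 hn⟩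

/-- Since `cn` increases with `c a`, it suffices to take `c a = 1`, where `cn` equals `4 (n + 2) /
(3 (n + 1))`. The consequence needed later is that `dn` is at least three times the Chebyshev
constant. -/
theorem two_mul_le_cn {a : ℝ} (hc : 1 ≤ c a) {n : ℕ} (hn : 1 ≤ n) :
    2 * (((n : ℝ) + 2) / (3 * n)) ≤ cn n a := by
  have hn' : (1 : ℝ) ≤ n := by exact_mod_cast hn
  have h1 : 2 * (((n : ℝ) + 2) / (3 * n)) ≤ (4 * n + 8) / (3 * (n + 1)) := by
    rw [← mul_div_assoc, div_le_div_iff₀ (by positivity) (by positivity)]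
    nlinarith
  have h2 : (4 * n + 8) / (3 * (n + 1)) =
      ((2 * (n : ℝ) + 1) / ((n : ℝ) + 1)) * ((3 + 1) / 6)
        + ((n : ℝ) * (1 + 1) + 2 * 1) / ((n : ℝ) + 1) ^ 2 := by
    field_simp
    ring
  rw [h2] at h1
  refine h1.trans ?_
  unfold cn
  gcongr

/-! ### A numerical tail comparison -/

theorem rpow_mul_rpow_mul_exp_eq {d x : ℝ} (hd : 0 < d) (hx : 0 < x) :
    d ^ (1 / 3 : ℝ) * x ^ (-(2 / 3) : ℝ) * Real.exp (-(x ^ 2) / (3 * d)) =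
      Real.exp (-(Real.log (x ^ 2 / d) + x ^ 2 / d) / 3) := by
  rw [Real.rpow_def_of_pos hd, Real.rpow_def_of_pos hx, ← Real.exp_add, ← Real.exp_add,
    Real.log_div (by positivity) (by positivity), Real.log_pow]
  congr 1
  field_simp
  push_cast
  ring

/-- After cubing, the claim is `p ^ 3 u exp u ≤ 1`. The bound `p ≤ 1` suffices for `u ≤ 1/2`, the
bound `1 / (3u)` for `1/2 ≤ u ≤ 2`, and the exponential bound for `u ≥ 2`. -/
theorem le_exp_neg_log_add_div_three {p u : ℝ} (hu : 0 < u) (hp0 : 0 ≤ p) (hp1 : p ≤ 1)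
    (hp2 : p ≤ 1 / (3 * u)) (hp3 : p ≤ 2 * Real.exp (-(8 / 9 * u))) :
    p ≤ Real.exp (-(Real.log u + u) / 3) := by
  have key : p ^ 3 * (u * Real.exp u) ≤ 1 := by
    rcases le_total u (1 / 2) with h | h
    · have h1 : p ^ 3 ≤ 1 := pow_le_one₀ hp0 hp1
      have h2 : Real.exp u ≤ 2 := by
        have h3 : Real.exp u ^ 2 ≤ 2 ^ 2 := by
          rw [← Real.exp_nat_mul]
          calc Real.exp ((2 : ℕ) * u) ≤ Real.exp 1 := Real.exp_le_exp.2 (by push_cast; linarith)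
            _ ≤ 2 ^ 2 := by linarith [Real.exp_one_lt_d9]
        exact le_of_sq_le_sq h3 (by norm_num)
      calc p ^ 3 * (u * Real.exp u) ≤ 1 * (1 / 2 * 2) := by gcongr
        _ = 1 := by norm_num
    rcases le_total u 2 with h' | h'
    · have h1 : p ^ 3 ≤ (1 / (3 * u)) ^ 3 := by gcongr
      have h2 : Real.exp u ≤ 27 * u ^ 2 := by
        rcases le_total u 1 with h1 | h1
        · calc Real.exp u ≤ Real.exp 1 := Real.exp_le_exp.2 h1
            _ ≤ 27 * u ^ 2 := by nlinarith [Real.exp_one_lt_d9]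
        · calc Real.exp u ≤ Real.exp ((2 : ℕ) * 1) := Real.exp_le_exp.2 (by push_cast; linarith)
            _ = Real.exp 1 ^ 2 := Real.exp_nat_mul _ _
            _ ≤ 3 ^ 2 := by gcongr; linarith [Real.exp_one_lt_d9]
            _ ≤ 27 * u ^ 2 := by nlinarith
      calc p ^ 3 * (u * Real.exp u) ≤ (1 / (3 * u)) ^ 3 * (u * (27 * u ^ 2)) := by gcongr
        _ = 1 := by field_simp; norm_num
    · have h1 : p ^ 3 ≤ 8 * Real.exp (-(8 / 3 * u)) := by
        calc p ^ 3 ≤ (2 * Real.exp (-(8 / 9 * u))) ^ 3 := by gcongr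
          _ = 8 * Real.exp (-(8 / 3 * u)) := by
            rw [mul_pow, ← Real.exp_nat_mul]; push_cast; ring_nf
      -- The exponent is `8/3 - 1 = 5/3`. The exponential is bounded below by its tangent at `3`,
      -- with `exp 1` replaced by `2.7`.
      have h2 : 8 * u ≤ Real.exp (5 / 3 * u) := by
        have h3 : Real.exp (5 / 3 * u) = Real.exp 1 ^ 3 * Real.exp (5 / 3 * u - 3) := by
          rw [← Real.exp_nat_mul, ← Real.exp_add]; push_cast; ring_nf
        have h4 := Real.add_one_le_exp (5 / 3 * u - 3)
        have h5 : (2.7 : ℝ) ^ 3 ≤ Real.exp 1 ^ 3 := by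
          gcongr; linarith [Real.exp_one_gt_d9]
        rw [h3]
        calc 8 * u ≤ 2.7 ^ 3 * (5 / 3 * u - 3 + 1) := by nlinarith
          _ ≤ _ := by gcongr; linarith
      calc p ^ 3 * (u * Real.exp u) ≤ 8 * Real.exp (-(8 / 3 * u)) * (u * Real.exp u) := by gcongr
        _ = (8 * u) * Real.exp (-(5 / 3 * u)) := by
          rw [show -(5 / 3 * u) = -(8 / 3 * u) + u by ring, Real.exp_add]; ring
        _ ≤ Real.exp (5 / 3 * u) * Real.exp (-(5 / 3 * u)) := by gcongr
        _ = 1 := by rw [← Real.exp_add]; simp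
  rw [← pow_le_pow_iff_left₀ hp0 (Real.exp_pos _).le (by norm_num : 3 ≠ 0), ← Real.exp_nat_mul,
    show ((3 : ℕ) : ℝ) * (-(Real.log u + u) / 3) = -(Real.log u + u) by push_cast; ring,
    Real.exp_neg, Real.exp_add, Real.exp_log hu, ← one_div, le_div_iff₀ (by positivity)]
  exact key

/-! ### Hoeffding's lemma for a centred two-point law -/

/-- The weights make the law on `y + 1` and `y - 1` centred, and its support has width `2`. It is
applied with `y = X_n / (n + 2)`, the rescaled martingale increment being `y ± 1`. -/
theorem two_point_exp_le {y : ℝ} (hy : |y| ≤ 1) (s : ℝ) :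
    (1 - y) / 2 * Real.exp (s * (y + 1)) + (1 + y) / 2 * Real.exp (s * (y - 1))
      ≤ Real.exp (s ^ 2 / 2) := by
  obtain ⟨h1, h2⟩ := abs_le.1 hy
  have hp : 0 ≤ (1 - y) / 2 := by linarith
  have hq : 0 ≤ (1 + y) / 2 := by linarith
  let ν : Measure ℝ := ENNReal.ofReal ((1 - y) / 2) • Measure.dirac (y + 1)
    + ENNReal.ofReal ((1 + y) / 2) • Measure.dirac (y - 1)
  have hint (f : ℝ → ℝ) :
      ∫ z, f z ∂ν = (1 - y) / 2 * f (y + 1) + (1 + y) / 2 * f (y - 1) := by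
    have hi (b : ℝ) (r : ℝ) : Integrable f (ENNReal.ofReal r • Measure.dirac b) :=
      (integrable_dirac (by finiteness)).smul_measure ENNReal.ofReal_ne_top
    rw [integral_add_measure (hi _ _) (hi _ _), integral_smul_measure, integral_smul_measure,
      integral_dirac, integral_dirac, ENNReal.toReal_ofReal hp, ENNReal.toReal_ofReal hq]
    rfl
  have hν : IsProbabilityMeasure ν := ⟨by
    simp only [ν, Measure.add_apply, Measure.smul_apply, measure_univ, smul_eq_mul, mul_one]
    rw [← ENNReal.ofReal_add hp hq, ← ENNReal.ofReal_one]
    congr 1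
    ring⟩
  have hsupp : ∀ᵐ z ∂ν, id z ∈ Set.Icc (y - 1) (y + 1) := by
    rw [ae_add_measure_iff]
    constructor <;> refine Measure.ae_smul_measure ?_ _ <;>
      simp only [ae_dirac_eq, Filter.eventually_pure, id, Set.mem_Icc] <;> constructor <;> linarith
  have hmean : ∫ z, id z ∂ν = 0 := by rw [hint]; simp only [id]; ring
  have h := (hasSubgaussianMGF_of_mem_Icc_of_integral_eq_zero aemeasurable_id hsupp hmean).mgf_le s
  rw [mgf, hint] at h
  refine h.trans (Real.exp_le_exp.2 (le_of_eq ?_))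
  have : y + 1 - (y - 1) = 2 := by ring
  simp [this]

end IDLA

namespace IDLA

/-! ### The explorer stopped at its exit from the cluster -/

/-- Position at time `j` of the explorer with increments `s`, frozen once it has left `A`. -/
def stopped (A : Finset ℤ) (s : ℕ → ℤ) : ℕ → ℤ
  | 0 => 0
  | j + 1 => if stopped A s j ∈ A then stopped A s j + s j else stopped A s j

theorem stopped_succ (A : Finset ℤ) (s : ℕ → ℤ) (j : ℕ) :
    stopped A s (j + 1) = if stopped A s j ∈ A then stopped A s j + s j else stopped A s j := rfl

theorem stopped_eq_walk {A : Finset ℤ} {s : ℕ → ℤ} {j : ℕ} (h : ∀ i < j, walk s i ∈ A) :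
    stopped A s j = walk s j := by
  induction j with
  | zero => simp [stopped, walk]
  | succ j ih =>
    have hj := ih fun i hi => h i (by omega)
    rw [stopped_succ, hj, if_pos (h j (by omega))]
    simp [walk, Finset.sum_range_succ]

theorem stopped_eq_of_le {A : Finset ℤ} {s : ℕ → ℤ} {i j : ℕ} (h : stopped A s i ∉ A)
    (hij : i ≤ j) : stopped A s j = stopped A s i := by
  induction j, hij using Nat.le_induction with
  | base => rfl
  | succ j _ ih => rw [stopped_succ, ih, if_neg h]

/-- Freezing makes any time after the exit as good as the exit time, so `Nat.find` no longer has to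
be handled. -/
theorem settle_eq_insert {A : Finset ℤ} {s : ℕ → ℤ} {j : ℕ} (h : stopped A s j ∉ A) :
    settle A s = insert (stopped A s j) A := by
  classical
  have hex : ∃ j, walk s j ∉ A := by
    by_contra! hall
    exact h (stopped_eq_walk (fun i _ => hall i) ▸ hall j)
  have hN : stopped A s (Nat.find hex) = walk s (Nat.find hex) :=
    stopped_eq_walk fun i hi => not_not.1 (Nat.find_min hex hi)
  have hle : Nat.find hex ≤ j := by
    by_contra! hlt
    have hw : ∀ i ≤ j, walk s i ∈ A := fun i hi => not_not.1 (Nat.find_min hex (by omega))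
    exact h (stopped_eq_walk (fun i hi => hw i hi.le) ▸ hw j le_rfl)
  rw [stopped_eq_of_le (hN ▸ Nat.find_spec hex) hle, hN]
  simp only [settle, dif_pos hex]

theorem settle_eq_self {A : Finset ℤ} {s : ℕ → ℤ} (h : ∀ j, stopped A s j ∈ A) :
    settle A s = A := by
  have hw : ∀ j, walk s j ∈ A := by
    intro j
    induction j using Nat.strong_induction_on with
    | _ j ih => exact stopped_eq_walk ih ▸ h j
  simp [settle, hw]

/-- `A` is an integer interval with `n + 1` points containing the origin. -/
def IsBlock (n : ℕ) (A : Finset ℤ) : Prop :=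
  ∃ l : ℤ, l ≤ 0 ∧ 0 ≤ l + n ∧ A = Finset.Icc l (l + n)

theorem stopped_mem_Icc {l r : ℤ} {s : ℕ → ℤ} (hl : l ≤ 0) (hr : 0 ≤ r)
    (hs : ∀ j, s j = 1 ∨ s j = -1) (j : ℕ) :
    stopped (Finset.Icc l r) s j ∈ Set.Icc (l - 1) (r + 1) := by
  rw [Set.mem_Icc]
  induction j with
  | zero => simp only [stopped]; omega
  | succ j ih =>
    rw [stopped_succ]
    split_ifs with h
    · rw [Finset.mem_Icc] at h
      have := hs j
      omega
    · exact ih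

theorem IsBlock.abs_stopped_le {n : ℕ} {A : Finset ℤ} (hA : IsBlock n A) {s : ℕ → ℤ}
    (hs : ∀ j, s j = 1 ∨ s j = -1) (j : ℕ) : |stopped A s j| ≤ n + 1 := by
  obtain ⟨l, hl, hr, rfl⟩ := hA
  obtain ⟨h1, h2⟩ := stopped_mem_Icc hl hr hs j
  rw [abs_le]
  omega

theorem IsBlock.settle_cases {n : ℕ} {A : Finset ℤ} (hA : IsBlock n A) {s : ℕ → ℤ}
    (hs : ∀ j, s j = 1 ∨ s j = -1) {j : ℕ} (hj : stopped A s j ∉ A) :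
    ∃ l : ℤ, l ≤ 0 ∧ 0 ≤ l + n ∧ A = Finset.Icc l (l + n) ∧
      ((stopped A s j = l - 1 ∧ settle A s = Finset.Icc (l - 1) (l + n)) ∨
        (stopped A s j = l + n + 1 ∧ settle A s = Finset.Icc l (l + n + 1))) := by
  rw [settle_eq_insert hj]
  obtain ⟨l, hl, hr, rfl⟩ := hA
  obtain ⟨h1, h2⟩ := stopped_mem_Icc hl hr hs j
  refine ⟨l, hl, hr, rfl, ?_⟩
  generalize stopped (Finset.Icc l (l + ↑n)) s j = z at *
  rw [Finset.mem_Icc] at hj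
  have : z = l - 1 ∨ z = l + n + 1 := by omega
  refine this.imp (fun h => ⟨h, ?_⟩) (fun h => ⟨h, ?_⟩) <;> ext y <;>
    simp only [Finset.mem_insert, Finset.mem_Icc] <;> omega

theorem IsBlock.settle {n : ℕ} {A : Finset ℤ} (hA : IsBlock n A) {s : ℕ → ℤ}
    (hs : ∀ j, s j = 1 ∨ s j = -1) {j : ℕ} (hj : stopped A s j ∉ A) :
    IsBlock (n + 1) (settle A s) := by
  obtain ⟨l, hl, hr, -, ⟨-, h⟩ | ⟨-, h⟩⟩ := hA.settle_cases hs hj <;> rw [h]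
  · exact ⟨l - 1, by omega, by push_cast; omega, by push_cast; congr 1; ring⟩
  · exact ⟨l, by omega, by push_cast; omega, by push_cast; congr 1; ring⟩

/-! ### The sum of the endpoints -/

/-- The sum of the minimum and the maximum of a finite set of integers (`0` if it is empty). -/
noncomputable def endpointSum (A : Finset ℤ) : ℤ :=
  if h : A.Nonempty then A.min' h + A.max' h else 0

theorem X_eq_endpointSum (s : ℕ → ℕ → ℤ) (n : ℕ) : X s n = endpointSum (cluster s n) := by
  rw [endpointSum, dif_pos (cluster_nonempty s n)]
  rfl

theorem endpointSum_Icc {l r : ℤ} (h : l ≤ r) : endpointSum (Finset.Icc l r) = l + r := by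
  have hne : (Finset.Icc l r).Nonempty := Finset.nonempty_Icc.2 h
  rw [endpointSum, dif_pos hne]
  congr 1
  · refine le_antisymm (Finset.min'_le _ _ (Finset.left_mem_Icc.2 h)) ?_
    exact (Finset.mem_Icc.1 (Finset.min'_mem _ hne)).1
  · refine le_antisymm (Finset.mem_Icc.1 (Finset.max'_mem _ hne)).2 ?_
    exact Finset.le_max' _ _ (Finset.right_mem_Icc.2 h)

theorem IsBlock.abs_endpointSum_le {n : ℕ} {A : Finset ℤ} (hA : IsBlock n A) :
    |endpointSum A| ≤ n := by
  obtain ⟨l, hl, hr, rfl⟩ := hA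
  rw [endpointSum_Icc (by omega), abs_le]
  omega

/-- The second identity is the source of the martingale: it expresses the exit position as half the
increment of `(n + 1) X_n`. -/
theorem IsBlock.endpointSum_settle {n : ℕ} {A : Finset ℤ} (hA : IsBlock n A) {s : ℕ → ℤ}
    (hs : ∀ j, s j = 1 ∨ s j = -1) {j : ℕ} (hj : stopped A s j ∉ A) :
    (endpointSum (IDLA.settle A s) = endpointSum A + 1 ∨
      endpointSum (IDLA.settle A s) = endpointSum A - 1) ∧
    2 * stopped A s j = (n + 2) * endpointSum (IDLA.settle A s) - (n + 1) * endpointSum A := by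
  obtain ⟨l, hl, hr, hA', ⟨h1, h2⟩ | ⟨h1, h2⟩⟩ := hA.settle_cases hs hj <;>
    rw [h2, h1, hA', endpointSum_Icc (by omega), endpointSum_Icc (by omega)]
  · exact ⟨Or.inr (by ring), by ring⟩
  · exact ⟨Or.inl (by ring), by ring⟩

/-! ### Measurability of the settling map -/

instance : MeasurableSpace (Finset ℤ) := ⊤

instance : DiscreteMeasurableSpace (Finset ℤ) := ⟨fun _ => trivial⟩

theorem measurable_stopped (A : Finset ℤ) (j : ℕ) : Measurable fun s => stopped A s j := by
  induction j with
  | zero => exact measurable_const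
  | succ j ih =>
    exact (Measurable.of_discrete (f := fun p : ℤ × ℤ => if p.1 ∈ A then p.1 + p.2 else p.1)).comp
      (ih.prodMk (measurable_pi_apply j))

theorem measurable_settle (A : Finset ℤ) : Measurable (settle A) := by
  refine measurable_to_countable' fun B => ?_
  -- Splitting by a time at which the explorer is outside, or by its never leaving, leaves only
  -- countably many conditions on the measurable positions `stopped A s j`.
  have h : settle A ⁻¹' {B} =
      (⋃ j, {s | stopped A s j ∉ A ∧ insert (stopped A s j) A = B}) ∪
        {s | (∀ j, stopped A s j ∈ A) ∧ A = B} := by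
    ext s
    simp only [Set.mem_preimage, Set.mem_singleton_iff, Set.mem_union, Set.mem_iUnion,
      Set.mem_ofPred_eq]
    by_cases hs : ∀ j, stopped A s j ∈ A
    · simp [settle_eq_self hs, hs]
    · push Not at hs
      obtain ⟨j, hj⟩ := hs
      refine ⟨fun h => Or.inl ⟨j, hj, by rw [← settle_eq_insert hj, h]⟩, ?_⟩
      rintro (⟨i, hi, h⟩ | ⟨h, -⟩)
      · rw [settle_eq_insert hi, h]
      · exact absurd (h j) hj
  rw [h]
  refine (MeasurableSet.iUnion fun j => ?_).union ?_
  · exact measurable_stopped A j (.of_discrete (s := {z : ℤ | z ∉ A ∧ insert z A = B}))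
  · simp only [Set.ofPred_and, Set.ofPred_forall]
    exact (MeasurableSet.iInter fun j => measurable_stopped A j (.of_discrete (s := {z | z ∈ A}))).inter
      (MeasurableSet.const _)

end IDLA

namespace IDLA

/-! ### The cluster process driven by independent simple random walks -/

/-- The increments `ξ k j` are independent and uniform on `{1, -1}`. -/
structure IsExplorers {Ω : Type*} [MeasurableSpace Ω] (μ : Measure Ω) (ξ : ℕ → ℕ → Ω → ℤ) :
    Prop where
  measurable : ∀ k j, Measurable (ξ k j)
  indep : iIndepFun (fun (p : ℕ × ℕ) => ξ p.1 p.2) μ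
  right : ∀ k j, μ.real {ω | ξ k j ω = 1} = 1 / 2
  left : ∀ k j, μ.real {ω | ξ k j ω = -1} = 1 / 2

variable {Ω : Type*} {ξ : ℕ → ℕ → Ω → ℤ}

/-- The information carried by the first `n` explorers and the first `j` steps of the next one. -/
@[reducible]
def past (ξ : ℕ → ℕ → Ω → ℤ) (n j : ℕ) : MeasurableSpace Ω :=
  ⨆ p ∈ {p : ℕ × ℕ | p.1 < n ∨ (p.1 = n ∧ p.2 < j)},
    MeasurableSpace.comap (ξ p.1 p.2) inferInstance

/-- The random cluster after `n` explorers. -/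
noncomputable def randomCluster (ξ : ℕ → ℕ → Ω → ℤ) (n : ℕ) (ω : Ω) : Finset ℤ :=
  cluster (fun k j => ξ k j ω) n

/-- The position at time `j` of the explorer which enlarges the cluster after `n` explorers. -/
noncomputable def explorer (ξ : ℕ → ℕ → Ω → ℤ) (n j : ℕ) (ω : Ω) : ℤ :=
  stopped (randomCluster ξ n ω) (fun i => ξ n i ω) j

/-- The process `X` as a function on the probability space. -/
noncomputable def process (ξ : ℕ → ℕ → Ω → ℤ) (n : ℕ) (ω : Ω) : ℤ :=
  endpointSum (randomCluster ξ n ω)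

theorem measurable_past_increment {n j k i : ℕ} (h : k < n ∨ (k = n ∧ i < j)) :
    Measurable[past ξ n j] (ξ k i) := by
  refine (comap_measurable (ξ k i)).mono ?_ le_rfl
  exact le_iSup₂ (f := fun (p : ℕ × ℕ) (_ : p ∈ {p : ℕ × ℕ | p.1 < n ∨ (p.1 = n ∧ p.2 < j)}) =>
    MeasurableSpace.comap (ξ p.1 p.2) inferInstance) (k, i) h

theorem past_mono {n j m i : ℕ} (h : n < m ∨ (n = m ∧ j ≤ i)) : past ξ n j ≤ past ξ m i := by
  refine biSup_mono fun p hp => ?_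
  simp only [Set.mem_ofPred_eq] at hp ⊢
  omega

theorem measurable_past_randomCluster (n j : ℕ) : Measurable[past ξ n j] (randomCluster ξ n) := by
  induction n generalizing j with
  | zero => exact measurable_const
  | succ n ih =>
    have hK : Measurable[past ξ (n + 1) j] (randomCluster ξ n) :=
      (ih 0).mono (past_mono (Or.inl n.lt_succ_self)) le_rfl
    have hs : Measurable[past ξ (n + 1) j] fun ω i => ξ n i ω :=
      @measurable_pi_lambda _ _ _ (past ξ (n + 1) j) _ _
        fun i => measurable_past_increment (Or.inl n.lt_succ_self)
    have hf : Measurable fun p : Finset ℤ × (ℕ → ℤ) => settle p.1 p.2 :=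
      measurable_from_prod_countable_right measurable_settle
    exact hf.comp (hK.prodMk hs)

theorem measurable_past_explorer (n j : ℕ) : Measurable[past ξ n j] (explorer ξ n j) := by
  induction j with
  | zero => exact measurable_const
  | succ j ih =>
    have hle : past ξ n j ≤ past ξ n (j + 1) := past_mono (Or.inr ⟨rfl, j.le_succ⟩)
    exact (Measurable.of_discrete (f := fun p : (ℤ × Finset ℤ) × ℤ =>
      if p.1.1 ∈ p.1.2 then p.1.1 + p.2 else p.1.1)).comp
        (((ih.mono hle le_rfl).prodMk (measurable_past_randomCluster n (j + 1))).prodMk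
          (measurable_past_increment (Or.inr ⟨rfl, j.lt_succ_self⟩)))

variable [mΩ : MeasurableSpace Ω] {μ : Measure Ω}

namespace IsExplorers

theorem past_le (h : IsExplorers μ ξ) (n j : ℕ) : past ξ n j ≤ mΩ :=
  iSup₂_le fun p _ => (h.measurable p.1 p.2).comap_le

theorem measurable_randomCluster (h : IsExplorers μ ξ) (n : ℕ) :
    Measurable (randomCluster ξ n) :=
  (measurable_past_randomCluster n 0).mono (h.past_le n 0) le_rfl

theorem measurable_explorer (h : IsExplorers μ ξ) (n j : ℕ) : Measurable (explorer ξ n j) :=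
  (measurable_past_explorer n j).mono (h.past_le n j) le_rfl

theorem measurable_process (h : IsExplorers μ ξ) (n : ℕ) : Measurable (process ξ n) :=
  (Measurable.of_discrete (f := endpointSum)).comp (h.measurable_randomCluster n)

theorem indepFun_past (h : IsExplorers μ ξ) {n j : ℕ} {F : Ω → ℝ}
    (hF : Measurable[past ξ n j] F) : IndepFun F (ξ n j) μ := by
  have h1 := indep_iSup_of_disjoint (fun p => (h.measurable p.1 p.2).comap_le)
    ((iIndepFun_iff_iIndep _ _ _).1 h.indep)
    (S := {p : ℕ × ℕ | p.1 < n ∨ (p.1 = n ∧ p.2 < j)}) (T := {(n, j)})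
    (by rw [Set.disjoint_singleton_right]; simp)
  rw [IndepFun_iff_Indep]
  refine indep_of_indep_of_le_left (indep_of_indep_of_le_right h1 ?_) hF.comap_le
  simp

variable [IsProbabilityMeasure μ]

theorem ae_increment (h : IsExplorers μ ξ) (k : ℕ) : ∀ᵐ ω ∂μ, ∀ j, ξ k j ω = 1 ∨ ξ k j ω = -1 := by
  refine ae_all_iff.2 fun j => ?_
  have hm (z : ℤ) : MeasurableSet {ω | ξ k j ω = z} := h.measurable k j (measurableSet_singleton z)
  have hd : Disjoint {ω | ξ k j ω = 1} {ω | ξ k j ω = -1} :=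
    Set.disjoint_left.2 fun ω h1 h2 => by
      simp only [Set.mem_ofPred_eq] at h1 h2
      omega
  have h1 := measureReal_union (μ := μ) hd (hm _)
  rw [h.right, h.left] at h1
  have h2 : μ ({ω | ξ k j ω = 1} ∪ {ω | ξ k j ω = -1}) = 1 := by
    rw [← ENNReal.toReal_eq_one_iff]
    simpa [Measure.real] using h1.trans (by norm_num)
  exact (mem_ae_iff_prob_eq_one ((hm _).union (hm _))).2 h2

theorem integral_increment (h : IsExplorers μ ξ) (k j : ℕ) : ∫ ω, (ξ k j ω : ℝ) ∂μ = 0 := by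
  have hm (z : ℤ) : MeasurableSet {ω | ξ k j ω = z} := h.measurable k j (measurableSet_singleton z)
  have h1 : ∀ᵐ ω ∂μ, (ξ k j ω : ℝ) =
      {ω | ξ k j ω = 1}.indicator 1 ω - {ω | ξ k j ω = -1}.indicator 1 ω := by
    filter_upwards [h.ae_increment k] with ω hω
    rcases hω j with h | h <;> simp [Set.indicator, h]
  have hi (z : ℤ) : Integrable ({ω | ξ k j ω = z}.indicator (1 : Ω → ℝ)) μ :=
    (integrable_const (1 : ℝ)).indicator (hm z)
  rw [integral_congr_ae h1, integral_sub (hi _) (hi _), integral_indicator_one (hm _),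
    integral_indicator_one (hm _), h.right, h.left, sub_self]

theorem integral_mul_increment (h : IsExplorers μ ξ) {n j : ℕ} {F : Ω → ℝ}
    (hF : Measurable[past ξ n j] F) : ∫ ω, F ω * (ξ n j ω : ℝ) ∂μ = 0 := by
  have h1 : IndepFun F (fun ω => (ξ n j ω : ℝ)) μ :=
    (h.indepFun_past hF).comp measurable_id (Measurable.of_discrete (f := fun z : ℤ => (z : ℝ)))
  have hm : Measurable fun ω => (ξ n j ω : ℝ) :=
    (Measurable.of_discrete (f := fun z : ℤ => (z : ℝ))).comp (h.measurable n j)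
  rw [h1.integral_fun_mul_eq_mul_integral (hF.mono (h.past_le n j) le_rfl).aestronglyMeasurable
    hm.aestronglyMeasurable, h.integral_increment, mul_zero]

/-! ### Every explorer settles -/

theorem ae_abs_explorer_le (h : IsExplorers μ ξ) {n : ℕ}
    (hb : ∀ᵐ ω ∂μ, IsBlock n (randomCluster ξ n ω)) :
    ∀ᵐ ω ∂μ, ∀ j, |(explorer ξ n j ω : ℝ)| ≤ n + 1 := by
  filter_upwards [hb, h.ae_increment n] with ω h1 h2 j
  exact_mod_cast h1.abs_stopped_le h2 j

/-- While the explorer is inside, its square grows by `2 Z ξ + 1`; the cross term has mean zero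
because the new step is independent of the past. -/
theorem integral_explorer_sq_succ (h : IsExplorers μ ξ) {n : ℕ}
    (hb : ∀ᵐ ω ∂μ, IsBlock n (randomCluster ξ n ω)) (j : ℕ) :
    ∫ ω, (explorer ξ n (j + 1) ω : ℝ) ^ 2 ∂μ = ∫ ω, (explorer ξ n j ω : ℝ) ^ 2 ∂μ +
      μ.real {ω | explorer ξ n j ω ∈ randomCluster ξ n ω} := by
  have hS : MeasurableSet {ω | explorer ξ n j ω ∈ randomCluster ξ n ω} :=
    ((h.measurable_explorer n j).prodMk (h.measurable_randomCluster n))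
      (.of_discrete (s := {p : ℤ × Finset ℤ | p.1 ∈ p.2}))
  let F : Ω → ℝ := fun ω =>
    if explorer ξ n j ω ∈ randomCluster ξ n ω then 2 * (explorer ξ n j ω : ℝ) else 0
  have hF : Measurable[past ξ n j] F :=
    (Measurable.of_discrete (f := fun p : ℤ × Finset ℤ => if p.1 ∈ p.2 then 2 * (p.1 : ℝ) else 0)).comp
      ((measurable_past_explorer n j).prodMk (measurable_past_randomCluster n j))
  have hbd := h.ae_abs_explorer_le hb
  have hi1 : Integrable (fun ω => (explorer ξ n j ω : ℝ) ^ 2) μ := by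
    refine Integrable.of_bound (C := ((n : ℝ) + 1) ^ 2) ?_ ?_
    · exact ((Measurable.of_discrete (f := fun z : ℤ => (z : ℝ) ^ 2)).comp
        (h.measurable_explorer n j)).aestronglyMeasurable
    · filter_upwards [hbd] with ω hω
      rw [norm_pow, Real.norm_eq_abs]
      exact pow_le_pow_left₀ (abs_nonneg _) (hω j) 2
  have hi2 : Integrable (fun ω => F ω * (ξ n j ω : ℝ)) μ := by
    refine Integrable.of_bound (C := 2 * ((n : ℝ) + 1)) ?_ ?_
    · exact ((hF.mono (h.past_le n j) le_rfl).mul ((Measurable.of_discrete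
        (f := fun z : ℤ => (z : ℝ))).comp (h.measurable n j))).aestronglyMeasurable
    · filter_upwards [hbd, h.ae_increment n] with ω hω h1
      have h2 : |(ξ n j ω : ℝ)| = 1 := by rcases h1 j with h | h <;> simp [h]
      have h3 : |F ω| ≤ 2 * |(explorer ξ n j ω : ℝ)| := by
        simp only [F]
        split_ifs
        · rw [abs_mul, abs_two]
        · simp
      rw [norm_mul, Real.norm_eq_abs, Real.norm_eq_abs, h2]
      linarith [hω j]
  have hi3 : Integrable ({ω | explorer ξ n j ω ∈ randomCluster ξ n ω}.indicator (1 : Ω → ℝ)) μ :=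
    (integrable_const (1 : ℝ)).indicator hS
  have heq : ∀ᵐ ω ∂μ, (explorer ξ n (j + 1) ω : ℝ) ^ 2 = (explorer ξ n j ω : ℝ) ^ 2 +
      F ω * (ξ n j ω : ℝ) +
      {ω | explorer ξ n j ω ∈ randomCluster ξ n ω}.indicator (1 : Ω → ℝ) ω := by
    filter_upwards [h.ae_increment n] with ω hω
    have h1 : (ξ n j ω : ℝ) ^ 2 = 1 := by rcases hω j with h | h <;> simp [h]
    have h2 : explorer ξ n (j + 1) ω = if explorer ξ n j ω ∈ randomCluster ξ n ω then
      explorer ξ n j ω + ξ n j ω else explorer ξ n j ω := rfl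
    rw [h2]
    by_cases hm : explorer ξ n j ω ∈ randomCluster ξ n ω
    · simp only [F, hm, if_true, Set.indicator, Set.mem_ofPred_eq, Pi.one_apply]
      push_cast
      linear_combination h1
    · simp [F, hm, Set.indicator]
  rw [integral_congr_ae heq, integral_add
    (f := fun ω => (explorer ξ n j ω : ℝ) ^ 2 + F ω * (ξ n j ω : ℝ)) (hi1.add hi2) hi3, integral_add hi1 hi2,
    h.integral_mul_increment hF, integral_indicator_one hS, add_zero]

/-- Each step adds at least the probability of never leaving to the second moment, which stays below
`(n + 1) ^ 2`; that probability is therefore zero. -/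
theorem ae_exists_explorer_notMem (h : IsExplorers μ ξ) {n : ℕ}
    (hb : ∀ᵐ ω ∂μ, IsBlock n (randomCluster ξ n ω)) :
    ∀ᵐ ω ∂μ, ∃ j, explorer ξ n j ω ∉ randomCluster ξ n ω := by
  set S : Set Ω := {ω | ∀ j, explorer ξ n j ω ∈ randomCluster ξ n ω} with hS
  have h1 (j : ℕ) : j * μ.real S ≤ ∫ ω, (explorer ξ n j ω : ℝ) ^ 2 ∂μ := by
    induction j with
    | zero => simpa using integral_nonneg fun ω => sq_nonneg (explorer ξ n 0 ω : ℝ)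
    | succ j ih =>
      have h2 : μ.real S ≤ μ.real {ω | explorer ξ n j ω ∈ randomCluster ξ n ω} :=
        measureReal_mono fun ω hω => hω j
      rw [h.integral_explorer_sq_succ hb]
      push_cast
      linarith
  have h2 (j : ℕ) : j * μ.real S ≤ ((n : ℝ) + 1) ^ 2 := by
    refine (h1 j).trans ?_
    have h3 : ∀ᵐ ω ∂μ, ‖(explorer ξ n j ω : ℝ) ^ 2‖ ≤ ((n : ℝ) + 1) ^ 2 := by
      filter_upwards [h.ae_abs_explorer_le hb] with ω hω
      rw [norm_pow, Real.norm_eq_abs]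
      exact pow_le_pow_left₀ (abs_nonneg _) (hω j) 2
    have h4 := norm_integral_le_of_norm_le_const h3
    rw [probReal_univ, mul_one] at h4
    exact (le_abs_self _).trans h4
  have h3 : μ.real S = 0 := by
    by_contra hne
    have hpos : 0 < μ.real S := lt_of_le_of_ne measureReal_nonneg (Ne.symm hne)
    obtain ⟨j, hj⟩ := exists_nat_gt (((n : ℝ) + 1) ^ 2 / μ.real S)
    rw [div_lt_iff₀ hpos] at hj
    exact absurd (h2 j) (not_le.2 hj)
  rw [measureReal_eq_zero_iff] at h3
  rw [ae_iff]
  simpa [hS] using h3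

theorem ae_isBlock (h : IsExplorers μ ξ) (n : ℕ) :
    ∀ᵐ ω ∂μ, IsBlock n (randomCluster ξ n ω) := by
  induction n with
  | zero => exact ae_of_all _ fun ω => ⟨0, le_rfl, by simp, by simp [randomCluster, cluster]⟩
  | succ n ih =>
    filter_upwards [ih, h.ae_increment n, h.ae_exists_explorer_notMem ih] with ω h1 h2 h3
    obtain ⟨j, hj⟩ := h3
    exact h1.settle h2 hj

/-! ### The martingale `(n + 1) X_n` -/

theorem ae_abs_process_le (h : IsExplorers μ ξ) (n : ℕ) : ∀ᵐ ω ∂μ, |process ξ n ω| ≤ n := by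
  filter_upwards [h.ae_isBlock n] with ω hω using hω.abs_endpointSum_le

theorem ae_process_succ (h : IsExplorers μ ξ) (n : ℕ) :
    ∀ᵐ ω ∂μ, process ξ (n + 1) ω = process ξ n ω + 1 ∨ process ξ (n + 1) ω = process ξ n ω - 1 := by
  filter_upwards [h.ae_isBlock n, h.ae_increment n, h.ae_exists_explorer_notMem (h.ae_isBlock n)]
    with ω h1 h2 ⟨j, hj⟩
  exact (h1.endpointSum_settle h2 hj).1

theorem ae_exists_abs_comp_process_le (h : IsExplorers μ ξ) (n : ℕ) (g : ℤ → ℝ) :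
    ∃ C, ∀ᵐ ω ∂μ, |g (process ξ n ω)| ≤ C := by
  refine ⟨∑ k ∈ Finset.Icc (-(n : ℤ)) n, |g k|, ?_⟩
  filter_upwards [h.ae_abs_process_le n] with ω hω
  exact Finset.single_le_sum (f := fun k => |g k|) (fun k _ => abs_nonneg _)
    (Finset.mem_Icc.2 (abs_le.1 hω))

theorem integrable_comp_process (h : IsExplorers μ ξ) (n : ℕ) (g : ℤ → ℝ) :
    Integrable (fun ω => g (process ξ n ω)) μ := by
  obtain ⟨C, hC⟩ := h.ae_exists_abs_comp_process_le n g
  exact Integrable.of_bound (((Measurable.of_discrete (f := g)).comp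
    (h.measurable_process n)).aestronglyMeasurable) C hC

theorem integrable_comp_process_prod (h : IsExplorers μ ξ) (n : ℕ) (g : ℤ → ℤ → ℝ) :
    Integrable (fun ω => g (process ξ n ω) (process ξ (n + 1) ω)) μ := by
  refine Integrable.of_bound
    (C := ∑ k ∈ Finset.Icc (-(n : ℤ)) n ×ˢ Finset.Icc (-((n + 1 : ℕ) : ℤ)) (n + 1 : ℕ), |g k.1 k.2|)
    ?_ ?_
  · exact ((Measurable.of_discrete (f := fun p : ℤ × ℤ => g p.1 p.2)).comp
      ((h.measurable_process n).prodMk (h.measurable_process (n + 1)))).aestronglyMeasurable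
  · filter_upwards [h.ae_abs_process_le n, h.ae_abs_process_le (n + 1)] with ω h1 h2
    exact Finset.single_le_sum (f := fun k : ℤ × ℤ => |g k.1 k.2|) (fun k _ => abs_nonneg _)
      (Finset.mk_mem_product (Finset.mem_Icc.2 (abs_le.1 h1)) (Finset.mem_Icc.2 (abs_le.1 h2)))

/-- Optional stopping at a bounded time, tested against functions of `X_n` so that no conditional
expectation is needed. -/
theorem integral_comp_process_mul_explorer (h : IsExplorers μ ξ) (n : ℕ) (g : ℤ → ℝ) (j : ℕ) :
    ∫ ω, g (process ξ n ω) * (explorer ξ n j ω : ℝ) ∂μ = 0 := by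
  obtain ⟨C, hC⟩ := h.ae_exists_abs_comp_process_le n g
  have hbd := h.ae_abs_explorer_le (h.ae_isBlock n)
  induction j with
  | zero => simp [explorer, stopped]
  | succ j ih =>
    let F : Ω → ℝ := fun ω =>
      if explorer ξ n j ω ∈ randomCluster ξ n ω then g (process ξ n ω) else 0
    have hF : Measurable[past ξ n j] F :=
      (Measurable.of_discrete (f := fun p : ℤ × Finset ℤ =>
        if p.1 ∈ p.2 then g (endpointSum p.2) else 0)).comp
          ((measurable_past_explorer n j).prodMk (measurable_past_randomCluster n j))
    have hi1 : Integrable (fun ω => g (process ξ n ω) * (explorer ξ n j ω : ℝ)) μ := by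
      refine Integrable.of_bound (C := C * ((n : ℝ) + 1)) ?_ ?_
      · exact ((Measurable.of_discrete (f := fun p : ℤ × ℤ => g p.1 * (p.2 : ℝ))).comp
          ((h.measurable_process n).prodMk (h.measurable_explorer n j))).aestronglyMeasurable
      · filter_upwards [hbd, hC] with ω h1 h2
        rw [norm_mul]
        exact mul_le_mul h2 (h1 j) (norm_nonneg _) ((abs_nonneg _).trans h2)
    have hi2 : Integrable (fun ω => F ω * (ξ n j ω : ℝ)) μ := by
      refine Integrable.of_bound (C := C) ?_ ?_
      · exact ((hF.mono (h.past_le n j) le_rfl).mul ((Measurable.of_discrete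
          (f := fun z : ℤ => (z : ℝ))).comp (h.measurable n j))).aestronglyMeasurable
      · filter_upwards [hC, h.ae_increment n] with ω h1 h2
        have h3 : |(ξ n j ω : ℝ)| = 1 := by rcases h2 j with h | h <;> simp [h]
        rw [norm_mul, Real.norm_eq_abs, Real.norm_eq_abs, h3, mul_one]
        simp only [F]
        split_ifs
        · exact h1
        · simpa using (abs_nonneg _).trans h1
    have heq (ω : Ω) : g (process ξ n ω) * (explorer ξ n (j + 1) ω : ℝ) =
        g (process ξ n ω) * (explorer ξ n j ω : ℝ) + F ω * (ξ n j ω : ℝ) := by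
      have h2 : explorer ξ n (j + 1) ω = if explorer ξ n j ω ∈ randomCluster ξ n ω then
        explorer ξ n j ω + ξ n j ω else explorer ξ n j ω := rfl
      rw [h2]
      by_cases hm : explorer ξ n j ω ∈ randomCluster ξ n ω
      · simp only [F, hm, if_true]
        push_cast
        ring
      · simp [F, hm]
    simp_rw [heq]
    rw [integral_add hi1 hi2, ih, h.integral_mul_increment hF, add_zero]

/-- The explorer's position is bounded and eventually constant in `j`, so dominated convergence
carries the zero mean over to the exit position. -/
theorem integral_comp_process_mul_increment (h : IsExplorers μ ξ) (n : ℕ) (g : ℤ → ℝ) :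
    ∫ ω, g (process ξ n ω) *
      (((n : ℝ) + 2) * process ξ (n + 1) ω - (n + 1) * process ξ n ω) ∂μ = 0 := by
  obtain ⟨C, hC⟩ := h.ae_exists_abs_comp_process_le n g
  have hbd := h.ae_abs_explorer_le (h.ae_isBlock n)
  have hlim : Filter.Tendsto (fun j => ∫ ω, g (process ξ n ω) * (explorer ξ n j ω : ℝ) ∂μ)
      Filter.atTop (nhds (∫ ω, g (process ξ n ω) *
        ((((n : ℝ) + 2) * process ξ (n + 1) ω - (n + 1) * process ξ n ω) / 2) ∂μ)) := by
    refine tendsto_integral_of_dominated_convergence (fun _ => C * ((n : ℝ) + 1)) (fun j => ?_)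
      (integrable_const _) (fun j => ?_) ?_
    · exact ((Measurable.of_discrete (f := fun p : ℤ × ℤ => g p.1 * (p.2 : ℝ))).comp
        ((h.measurable_process n).prodMk (h.measurable_explorer n j))).aestronglyMeasurable
    · filter_upwards [hbd, hC] with ω h1 h2
      rw [norm_mul]
      exact mul_le_mul h2 (h1 j) (norm_nonneg _) ((abs_nonneg _).trans h2)
    · filter_upwards [h.ae_isBlock n, h.ae_increment n,
        h.ae_exists_explorer_notMem (h.ae_isBlock n)] with ω h1 h2 ⟨i, hi⟩
      refine tendsto_const_nhds.congr' ?_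
      filter_upwards [Filter.eventually_ge_atTop i] with j hij
      have h3 : 2 * explorer ξ n i ω = (n + 2) * process ξ (n + 1) ω - (n + 1) * process ξ n ω :=
        (h1.endpointSum_settle h2 hi).2
      have h4 : explorer ξ n j ω = explorer ξ n i ω := stopped_eq_of_le hi hij
      rw [h4, mul_div_assoc']
      have h5 : 2 * (explorer ξ n i ω : ℝ) =
        (n + 2) * process ξ (n + 1) ω - (n + 1) * process ξ n ω := by exact_mod_cast h3
      rw [← h5]
      ring
  simp_rw [h.integral_comp_process_mul_explorer n g] at hlim
  have h0 := tendsto_nhds_unique hlim tendsto_const_nhds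
  simp_rw [mul_div_assoc', integral_div] at h0
  simpa using h0

end IsExplorers

end IDLA

/-! ### Moment bounds and tail estimates for the process -/

namespace IDLA

namespace IsExplorers

variable {Ω : Type*} {ξ : ℕ → ℕ → Ω → ℤ} [MeasurableSpace Ω] {μ : Measure Ω}
  [IsProbabilityMeasure μ]

/-- The conditional mean of `X_{n+1} - X_n` is `-X_n / (n + 2)`, so second moments satisfy `v_{n+1}
= n / (n + 2) * v_n + 1`; the sequence `(n + 2) / 3` solves this recursion exactly. -/
theorem integral_process_sq_le (h : IsExplorers μ ξ) (n : ℕ) :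
    ∫ ω, (process ξ n ω : ℝ) ^ 2 ∂μ ≤ ((n : ℝ) + 2) / 3 := by
  induction n with
  | zero =>
    have h0 : ∀ᵐ ω ∂μ, (process ξ 0 ω : ℝ) ^ 2 = 0 := by
      filter_upwards [h.ae_abs_process_le 0] with ω hω
      have : process ξ 0 ω = 0 := by simpa using hω
      simp [this]
    rw [integral_congr_ae h0]
    norm_num
  | succ n ih =>
    have heq : ∀ᵐ ω ∂μ, (process ξ (n + 1) ω : ℝ) ^ 2 =
        ((n : ℝ) / (n + 2) * (process ξ n ω : ℝ) ^ 2 + 1) +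
        2 / ((n : ℝ) + 2) * process ξ n ω *
          (((n : ℝ) + 2) * process ξ (n + 1) ω - (n + 1) * process ξ n ω) := by
      filter_upwards [h.ae_process_succ n] with ω hω
      rcases hω with hω | hω <;> rw [hω] <;> push_cast <;> field_simp <;> ring
    have hi1 : Integrable (fun ω => (n : ℝ) / (n + 2) * (process ξ n ω : ℝ) ^ 2) μ :=
      h.integrable_comp_process n fun k => (n : ℝ) / (n + 2) * (k : ℝ) ^ 2
    have hi2 := h.integrable_comp_process_prod n fun k m =>
      2 / ((n : ℝ) + 2) * k * (((n : ℝ) + 2) * m - (n + 1) * k)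
    rw [integral_congr_ae heq, integral_add
      (f := fun ω => (n : ℝ) / (n + 2) * (process ξ n ω : ℝ) ^ 2 + 1)
      (hi1.add (integrable_const _)) hi2,
      h.integral_comp_process_mul_increment n fun k => 2 / ((n : ℝ) + 2) * k,
      integral_add hi1 (integrable_const _), integral_const_mul]
    simp only [integral_const, probReal_univ, smul_eq_mul, mul_one, add_zero]
    calc (n : ℝ) / (n + 2) * ∫ ω, (process ξ n ω : ℝ) ^ 2 ∂μ + 1
        ≤ (n : ℝ) / (n + 2) * (((n : ℝ) + 2) / 3) + 1 := by gcongr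
      _ = (((n + 1 : ℕ) : ℝ) + 2) / 3 := by push_cast; field_simp; ring

theorem integral_exp_le (h : IsExplorers μ ξ) (t : ℝ) (n : ℕ) :
    ∫ ω, Real.exp (t * (((n : ℝ) + 1) * process ξ n ω)) ∂μ ≤ Real.exp (proxy n * t ^ 2 / 2) := by
  induction n with
  | zero =>
    have h0 : ∀ᵐ ω ∂μ, Real.exp (t * (((0 : ℕ) : ℝ) + 1) * process ξ 0 ω) = 1 := by
      filter_upwards [h.ae_abs_process_le 0] with ω hω
      have : process ξ 0 ω = 0 := by simpa using hω
      simp [this]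
    simp_rw [← mul_assoc]
    rw [integral_congr_ae h0]
    simp [proxy]
  | succ n ih =>
    set N : ℝ := (n : ℝ) + 2 with hN
    have hN0 : 0 < N := by positivity
    let E : ℤ → ℝ := fun k => Real.exp (t * (((n : ℝ) + 1) * k))
    let α : ℤ → ℝ := fun k => (1 - k / N) / 2 * Real.exp (t * N * (k / N + 1)) +
      (1 + k / N) / 2 * Real.exp (t * N * (k / N - 1))
    let β : ℤ → ℝ := fun k =>
      (Real.exp (t * N * (k / N + 1)) - Real.exp (t * N * (k / N - 1))) / (2 * N)
    -- On two points every function is affine: `α` is the mean under the two-point law and `β` the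
    -- slope in the martingale increment. The slope term then integrates to zero.
    have heq : ∀ᵐ ω ∂μ, Real.exp (t * ((((n + 1 : ℕ) : ℝ) + 1) * process ξ (n + 1) ω)) =
        E (process ξ n ω) * α (process ξ n ω) + E (process ξ n ω) * β (process ξ n ω) *
          (N * process ξ (n + 1) ω - (n + 1) * process ξ n ω) := by
      filter_upwards [h.ae_process_succ n] with ω hω
      have key (k d : ℝ) (hd : d = 1 ∨ d = -1) :
          Real.exp (t * (((n : ℝ) + 1 + 1) * (k + d))) =
            Real.exp (t * (((n : ℝ) + 1) * k)) * Real.exp (t * N * (k / N + d)) := by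
        rw [← Real.exp_add]
        congr 1
        field_simp
        rw [hN]
        ring
      rcases hω with hω | hω <;> rw [hω]
      · push_cast
        rw [key _ 1 (Or.inl rfl)]
        simp only [E, α, β]
        field_simp
        rw [hN]
        ring
      · push_cast
        rw [sub_eq_add_neg (process ξ n ω : ℝ) 1, key _ (-1) (Or.inr rfl)]
        simp only [E, α, β, ← sub_eq_add_neg]
        field_simp
        rw [hN]
        ring
    have hi1 : Integrable (fun ω => E (process ξ n ω) * α (process ξ n ω)) μ :=
      h.integrable_comp_process n fun k => E k * α k
    have hi2 := h.integrable_comp_process_prod n fun k m =>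
      E k * β k * (N * m - (n + 1) * k)
    rw [integral_congr_ae heq, integral_add hi1 hi2,
      h.integral_comp_process_mul_increment n fun k => E k * β k, add_zero]
    have hle : ∀ᵐ ω ∂μ, E (process ξ n ω) * α (process ξ n ω) ≤
        E (process ξ n ω) * Real.exp ((t * N) ^ 2 / 2) := by
      filter_upwards [h.ae_abs_process_le n] with ω hω
      refine mul_le_mul_of_nonneg_left (two_point_exp_le ?_ _) (Real.exp_pos _).le
      have : |(process ξ n ω : ℝ)| ≤ n := by exact_mod_cast hω
      rw [abs_div, abs_of_pos hN0, div_le_one hN0]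
      linarith
    calc ∫ ω, E (process ξ n ω) * α (process ξ n ω) ∂μ
        ≤ ∫ ω, E (process ξ n ω) * Real.exp ((t * N) ^ 2 / 2) ∂μ :=
          integral_mono_ae hi1 ((h.integrable_comp_process n E).mul_const _) hle
      _ = (∫ ω, E (process ξ n ω) ∂μ) * Real.exp ((t * N) ^ 2 / 2) := integral_mul_const _ _
      _ ≤ Real.exp (proxy n * t ^ 2 / 2) * Real.exp ((t * N) ^ 2 / 2) := by gcongr
      _ = Real.exp (proxy (n + 1) * t ^ 2 / 2) := by
        rw [← Real.exp_add, proxy, proxy, Finset.sum_range_succ]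
        congr 1
        ring

theorem hasSubgaussianMGF (h : IsExplorers μ ξ) (n : ℕ) :
    HasSubgaussianMGF (fun ω => ((n : ℝ) + 1) * process ξ n ω) (proxy n).toNNReal μ where
  integrable_exp_mul t := h.integrable_comp_process n fun k => Real.exp (t * (((n : ℝ) + 1) * k))
  mgf_le t := by
    rw [Real.coe_toNNReal _ (proxy_nonneg n)]
    exact h.integral_exp_le t n

theorem measureReal_le_abs_process_le (h : IsExplorers μ ξ) (n : ℕ) {z : ℝ} (hz : 0 ≤ z) :
    μ.real {ω | z ≤ |(process ξ n ω : ℝ)|} ≤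
      2 * Real.exp (-(((n : ℝ) + 1) * z) ^ 2 / (2 * proxy n)) := by
  have hS := h.hasSubgaussianMGF n
  have hz' : 0 ≤ ((n : ℝ) + 1) * z := by positivity
  have h1 := hS.measure_ge_le hz'
  have h2 := hS.neg.measure_ge_le hz'
  rw [Real.coe_toNNReal _ (proxy_nonneg n)] at h1 h2
  have hsub : {ω | z ≤ |(process ξ n ω : ℝ)|} ⊆
      {ω | ((n : ℝ) + 1) * z ≤ ((n : ℝ) + 1) * process ξ n ω} ∪
      {ω | ((n : ℝ) + 1) * z ≤ (-fun ω => ((n : ℝ) + 1) * (process ξ n ω : ℝ)) ω} := by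
    intro ω hω
    have hn : (0 : ℝ) ≤ n + 1 := by positivity
    rw [Set.mem_ofPred_eq] at hω
    rcases le_abs'.1 hω with hω | hω
    · right
      have := mul_le_mul_of_nonneg_left hω hn
      simp only [Set.mem_ofPred_eq, Pi.neg_apply]
      linarith
    · left
      exact mul_le_mul_of_nonneg_left hω hn
  calc μ.real {ω | z ≤ |(process ξ n ω : ℝ)|} ≤ _ := measureReal_mono hsub
    _ ≤ _ := measureReal_union_le _ _
    _ ≤ _ := add_le_add h1 h2
    _ = _ := by ring

theorem measureReal_le_abs_process_le_cn (h : IsExplorers μ ξ) {n : ℕ} (hn : 1 ≤ n) {a : ℝ}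
    (ha : 1 / 8 < a) {z : ℝ} (hz : 0 ≤ z) :
    μ.real {ω | z ≤ |(process ξ n ω : ℝ)|} ≤ 2 * Real.exp (-z ^ 2 / (2 * a * (n * cn n a))) := by
  refine (h.measureReal_le_abs_process_le n hz).trans ?_
  have hp := proxy_pos hn
  have hle := proxy_le ha n
  have hn1 : (0 : ℝ) < n + 1 := by positivity
  gcongr 2 * Real.exp ?_
  rw [neg_div, neg_div, neg_le_neg_iff]
  calc z ^ 2 / (2 * a * (n * cn n a))
      = (((n : ℝ) + 1) * z) ^ 2 / (2 * (a * ((n : ℝ) * (n + 1) ^ 2 * cn n a))) := by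
        rw [mul_pow, show 2 * (a * ((n : ℝ) * (n + 1) ^ 2 * cn n a)) =
          ((n : ℝ) + 1) ^ 2 * (2 * a * (n * cn n a)) by ring,
          mul_div_mul_left _ _ (by positivity)]
    _ ≤ (((n : ℝ) + 1) * z) ^ 2 / (2 * proxy n) := by gcongr

theorem measureReal_le_abs_process_le_div_sq (h : IsExplorers μ ξ) (n : ℕ) {z : ℝ} (hz : 0 < z) :
    μ.real {ω | z ≤ |(process ξ n ω : ℝ)|} ≤ ((n : ℝ) + 2) / 3 / z ^ 2 := by
  have h1 := mul_meas_ge_le_integral_of_nonneg (μ := μ)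
    (ae_of_all _ fun ω => sq_nonneg (process ξ n ω : ℝ))
    (h.integrable_comp_process n fun k => (k : ℝ) ^ 2) (z ^ 2)
  have h2 : {ω | z ≤ |(process ξ n ω : ℝ)|} ⊆ {ω | z ^ 2 ≤ (process ξ n ω : ℝ) ^ 2} := by
    intro ω hω
    rw [Set.mem_ofPred_eq, ← sq_abs (process ξ n ω : ℝ)]
    exact pow_le_pow_left₀ hz.le hω 2
  rw [le_div_iff₀ (by positivity), mul_comm]
  calc z ^ 2 * μ.real {ω | z ≤ |(process ξ n ω : ℝ)|}
      ≤ z ^ 2 * μ.real {ω | z ^ 2 ≤ (process ξ n ω : ℝ) ^ 2} := by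
        have := measureReal_mono (μ := μ) h2
        gcongr
    _ ≤ _ := h1.trans (h.integral_process_sq_le n)

end IsExplorers

end IDLA

theorem corollary3p2 {Ω : Type*} [MeasurableSpace Ω] (μ : Measure Ω) [IsProbabilityMeasure μ]
    (ξ : ℕ → ℕ → Ω → ℤ)
    (hmeas : ∀ k j, Measurable (ξ k j))
    (hindep : iIndepFun (fun (p : ℕ × ℕ) => ξ p.1 p.2) μ)
    (hright : ∀ k j, μ.real {ω | ξ k j ω = 1} = 1 / 2)
    (hleft : ∀ k j, μ.real {ω | ξ k j ω = -1} = 1 / 2)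
    (n : ℕ) (hn : 1 ≤ n) (a : ℝ) (ha : a ∈ Set.Ioc (1 / 8 : ℝ) (9 / 16)) (x : ℝ) (hx : 0 < x) :
    μ.real {ω | x ≤ |(IDLA.X (fun k j => ξ k j ω) n : ℝ)| / (n : ℝ)}
        ≤ 2 * Real.exp (-((n : ℝ) * x ^ 2) / (2 * a * IDLA.cn n a))
    ∧ μ.real {ω | x ≤ |(IDLA.X (fun k j => ξ k j ω) n : ℝ)| / Real.sqrt (n : ℝ)}
        ≤ (IDLA.dn n a) ^ (1 / 3 : ℝ) * x ^ (-(2 / 3) : ℝ)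
          * Real.exp (-(x ^ 2) / (3 * IDLA.dn n a)) := by
  have h : IDLA.IsExplorers μ ξ := ⟨hmeas, hindep, hright, hleft⟩
  have hX (ω : Ω) : IDLA.X (fun k j => ξ k j ω) n = IDLA.process ξ n ω :=
    IDLA.X_eq_endpointSum _ n
  simp_rw [hX]
  have hn0 : (0 : ℝ) < n := by exact_mod_cast hn
  constructor
  · simp_rw [le_div_iff₀ hn0]
    refine (h.measureReal_le_abs_process_le_cn hn ha.1 (by positivity)).trans (le_of_eq ?_)
    congr 2
    rw [show -(x * (n : ℝ)) ^ 2 = n * (-((n : ℝ) * x ^ 2)) by ring,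
      show 2 * a * ((n : ℝ) * IDLA.cn n a) = n * (2 * a * IDLA.cn n a) by ring,
      mul_div_mul_left _ _ hn0.ne']
  · have hs : 0 < Real.sqrt (n : ℝ) := Real.sqrt_pos.2 hn0
    have hsq : Real.sqrt (n : ℝ) ^ 2 = n := Real.sq_sqrt hn0.le
    simp_rw [le_div_iff₀ hs]
    have hv : 0 < ((n : ℝ) + 2) / (3 * n) := by positivity
    have hcv := IDLA.two_mul_le_cn (IDLA.one_le_c ha) hn
    have hc : 0 < IDLA.cn n a := by linarith
    have hdc : IDLA.cn n a ≤ IDLA.dn n a := by unfold IDLA.dn; linarith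
    have hdv : 3 * (((n : ℝ) + 2) / (3 * n)) ≤ IDLA.dn n a := by unfold IDLA.dn; linarith
    have hd : 0 < IDLA.dn n a := hc.trans_le hdc
    have ha0 : 0 < a := by linarith [ha.1]
    rw [IDLA.rpow_mul_rpow_mul_exp_eq hd hx]
    -- Here `u` is `x ^ 2 / dn n a`; Chebyshev and the sub-Gaussian bound supply the two remaining
    -- hypotheses.
    refine IDLA.le_exp_neg_log_add_div_three (by positivity) measureReal_nonneg measureReal_le_one
      ?_ ?_
    · refine (h.measureReal_le_abs_process_le_div_sq n (by positivity)).trans ?_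
      rw [mul_pow, hsq]
      calc ((n : ℝ) + 2) / 3 / (x ^ 2 * n) = ((n : ℝ) + 2) / (3 * n) / x ^ 2 := by field_simp
        _ ≤ IDLA.dn n a / 3 / x ^ 2 :=
          div_le_div_of_nonneg_right (by linarith) (by positivity)
        _ = 1 / (3 * (x ^ 2 / IDLA.dn n a)) := by field_simp
    · refine (h.measureReal_le_abs_process_le_cn hn ha.1 (by positivity)).trans ?_
      rw [mul_pow, hsq]
      gcongr 2 * Real.exp ?_
      rw [neg_div, neg_le_neg_iff]
      -- The rate `8/9` is `1 / (2 * (9/16))`, from `a ≤ 9/16` and `cn ≤ dn`.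
      calc 8 / 9 * (x ^ 2 / IDLA.dn n a) = x ^ 2 / (2 * (9 / 16) * IDLA.dn n a) := by
            field_simp; norm_num
        _ ≤ x ^ 2 / (2 * a * IDLA.cn n a) := by
            gcongr
            exact ha.2
        _ = x ^ 2 * n / (2 * a * (n * IDLA.cn n a)) := by field_simp
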